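/- Let $d\ge 1$ be an integer. All graphs are simple, and $d_G(x,y)$ denotes the distance in $G$ (with $d_G(x,y)=\infty$ if $x,y$ lie in different components). For a graph $G$, an integer $k$ and a finite set $N$, a labeling $\varphi:V(G)\to N$ is called *$k$-separating* if $\varphi(x)\neq\varphi(y)$ whenever $0<d_G(x,y)\le k$. Let $U_d^{r,k,N}$ be the set of isomorphism classes (root- and label-preserving) of rooted graphs of maximum degree at most $d$, all of whose vertices are at distance at most $r$ from the root, equipped with a $k$-separating labeling by $N$. A finite set $N$ is *$(k,d)$-large* if $|N|\ge |V(B)|$ for every rooted graph $B$ of maximum degree at most $d$ all of whose vertices are at distance at most $k$ from the root. A map $\Theta:U_d^{r,k,N}\to Q$ (an *oracle*, i.e. an $r$-round distributed algorithm) acts on $k$-separating labelings $\varphi:V(G)\to N$ of graphs $G$ of maximum degree at most $d$ by $O_\Theta(\varphi)(x)=\Theta(B_r(G,x,\varphi))$, where $B_r(G,x,\varphi)$ is the subgraph induced on the ball of radius $r$ around $x$, rooted at $x$ and labeled by $\varphi$. A map $\rho:V(G)\to Q$ is a *matching function* on $G$ if for every vertex $a$ there is at most one vertex $b$ with $0<d_G(a,b)\le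 5$ and $\rho(a)=\rho(b)$, and every such $b$ is adjacent to $a$; then the edges $ab$ of $G$ with $\rho(a)=\rho(b)$ form a matching $M_\rho$ of $G$. **Theorem.** For every $\varepsilon>0$ there exist integers $1\le n\le l$, a finite $(n,d)$-large set $N$, a finite $(5,d)$-large set $Q$ and an oracle $\Theta:U_d^{l,n,N}\to Q$ such that for every finite graph $G$ of maximum degree at most $d$ and every $n$-separating labeling $\varphi:V(G)\to N$, the labeling $\rho=O_\Theta(\varphi)$ is a matching function on $G$, and the matching $M_\rho$ satisfies $$|M_\rho|\ \ge\ \nu(G)-\varepsilon\,|V(G)|,$$ where $\nu(G)$ is the maximum number of edges of a matching of $G$. -/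

import Mathlib

namespace LocalMatching

/-- Every vertex of `G` has at most `d` neighbours. -/
def DegreeBounded {V : Type*} (G : SimpleGraph V) (d : ℕ) : Prop :=
  ∀ x, (G.neighborSet x).encard ≤ d

/-- `φ` is a `k`-separating labeling of `G`: distinct vertices at distance at most `k`
have different labels. (Vertices in different components have `edist` equal to `⊤`.) -/
def IsSeparating {V Q : Type*} (G : SimpleGraph V) (k : ℕ) (φ : V → Q) : Prop :=
  ∀ x y, 0 < G.edist x y → G.edist x y ≤ k → φ x ≠ φ y

/-- A rooted ball of radius `r` and vertex degree bound `d` (with an enumerated vertex set). -/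
structure RootedBall (d r : ℕ) where
  size : ℕ
  graph : SimpleGraph (Fin size)
  root : Fin size
  edist_le : ∀ y, graph.edist root y ≤ r
  degree_le : DegreeBounded graph d

/-- A rooted ball of radius `r` and vertex degree bound `d`, with a `k`-separating `Q`-labeling. -/
structure LabeledBall (d r k : ℕ) (Q : Type*) extends RootedBall d r where
  label : Fin size → Q
  separating : IsSeparating graph k label

/-- Rooted labeled isomorphism. -/
instance LabeledBall.instSetoid (d r k : ℕ) (Q : Type*) : Setoid (LabeledBall d r k Q) where
  r B C := ∃ e : B.graph ≃g C.graph, e B.root = C.root ∧ ∀ y, C.label (e y) = B.label y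
  iseqv :=
    { refl := fun _ => ⟨SimpleGraph.Iso.refl, rfl, fun _ => rfl⟩
      symm := by
        rintro B C ⟨e, h1, h2⟩
        refine ⟨e.symm, ?_, fun y => ?_⟩
        · rw [← h1]; exact e.symm_apply_apply _
        · rw [← h2]; exact congrArg C.label (e.apply_symm_apply y)
      trans := by
        rintro A B C ⟨e, h1, h2⟩ ⟨f, h3, h4⟩
        refine ⟨f.comp e, ?_, fun y => ?_⟩
        · rw [← h3, ← h1]; rfl
        · rw [← h2, ← h4]; rfl }

/-- The set of all `k`-separating `Q`-labeled rooted balls of radius `r` and vertex degree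
bound `d`, up to rooted labeled isomorphism. -/
def BallType (d r k : ℕ) (Q : Type*) : Type _ :=
  Quotient (LabeledBall.instSetoid d r k Q)

/-- `Q` is `(k, d)`-large: it has at least as many elements as any ball of radius `k` and
vertex degree bound `d` has vertices. -/
def IsLarge (k d : ℕ) (Q : Type*) : Prop :=
  ∀ B : RootedBall d k, B.size ≤ Nat.card Q

/-- The vertex set of the ball of radius `r` around `x`. -/
def ballSet {V : Type*} (G : SimpleGraph V) (r : ℕ) (x : V) : Set V :=
  {y | G.edist x y ≤ r}

/-- The ball of radius `r` around `x`, as an induced subgraph. -/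
abbrev ballGraph {V : Type*} (G : SimpleGraph V) (r : ℕ) (x : V) :
    SimpleGraph (ballSet G r x) :=
  G.induce (ballSet G r x)

theorem mem_ballSet_self {V : Type*} (G : SimpleGraph V) (r : ℕ) (x : V) :
    x ∈ ballSet G r x := by
  simp [ballSet]

theorem edist_map_le {V W : Type*} {G : SimpleGraph V} {H : SimpleGraph W}
    (f : G →g H) (x y : V) : H.edist (f x) (f y) ≤ G.edist x y := by
  by_cases h : G.Reachable x y
  · obtain ⟨p, hp⟩ := h.exists_walk_length_eq_edist
    rw [← hp, ← SimpleGraph.Walk.length_map f p]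
    exact SimpleGraph.edist_le _
  · rw [SimpleGraph.edist_eq_top_of_not_reachable h]
    exact le_top

theorem edist_ballGraph_le {V : Type*} (G : SimpleGraph V) (r : ℕ) (x : V)
    (y : ballSet G r x) :
    (ballGraph G r x).edist ⟨x, mem_ballSet_self G r x⟩ y ≤ r := by
  have hy : G.edist x y ≤ r := y.2
  have hr : G.Reachable x y := by
    by_contra h
    rw [SimpleGraph.edist_eq_top_of_not_reachable h] at hy
    simp at hy
  obtain ⟨p, hp⟩ := hr.exists_walk_length_eq_edist
  rw [← hp] at hy
  have hs : ∀ z ∈ p.support, z ∈ ballSet G r x := by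
    classical
    intro z hz
    refine le_trans (SimpleGraph.edist_le (p.takeUntil z hz)) (le_trans ?_ hy)
    exact_mod_cast p.length_takeUntil_le_length hz
  have hq := SimpleGraph.edist_le (p.induce (ballSet G r x) hs)
  refine le_trans hq (le_trans (le_of_eq ?_) hy)
  congr 1
  rw [← SimpleGraph.Walk.length_map (SimpleGraph.Embedding.induce (ballSet G r x)).toHom,
    SimpleGraph.Walk.map_induce]
  rfl

theorem DegreeBounded.of_embedding {V W : Type*} {G : SimpleGraph V} {H : SimpleGraph W} {d : ℕ}
    (h : DegreeBounded H d) (f : G ↪g H) : DegreeBounded G d := by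
  intro x
  refine le_trans ?_ (h (f x))
  rw [← f.injective.encard_image]
  refine Set.encard_le_encard ?_
  rintro _ ⟨z, hz, rfl⟩
  exact f.map_adj_iff.2 hz

theorem IsSeparating.of_embedding {V W Q : Type*} {G : SimpleGraph V} {H : SimpleGraph W} {k : ℕ}
    {φ : W → Q} (h : IsSeparating H k φ) (f : G ↪g H) : IsSeparating G k (φ ∘ f) := by
  intro x y h0 hk
  refine h _ _ ?_ (le_trans (edist_map_le f.toHom x y) hk)
  rw [pos_iff_ne_zero, Ne, SimpleGraph.edist_eq_zero_iff] at h0 ⊢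
  exact fun he => h0 (f.injective he)

/-- An arbitrary enumeration of the vertices of the ball of radius `r` around `x`. -/
noncomputable def ballEquiv {V : Type*} [Finite V] (G : SimpleGraph V) (r : ℕ) (x : V) :
    Fin (Nat.card (ballSet G r x)) ≃ ballSet G r x :=
  (Finite.equivFin _).symm

/-- The ball of radius `r` around `x` in `G`, labeled by the restriction of `φ`. -/
noncomputable def labeledBall {V Q : Type*} [Finite V] {G : SimpleGraph V} {d k : ℕ} {φ : V → Q}
    (hG : DegreeBounded G d) (hφ : IsSeparating G k φ) (r : ℕ) (x : V) :
    LabeledBall d r k Q where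
  size := Nat.card (ballSet G r x)
  graph := (ballGraph G r x).comap (ballEquiv G r x)
  root := (ballEquiv G r x).symm ⟨x, mem_ballSet_self G r x⟩
  label := fun i => φ (ballEquiv G r x i)
  edist_le := fun i => by
    have h1 := edist_map_le (SimpleGraph.Iso.comap (ballEquiv G r x) (ballGraph G r x)).symm.toHom
      ⟨x, mem_ballSet_self G r x⟩ (ballEquiv G r x i)
    have h2 := le_trans h1 (edist_ballGraph_le G r x _)
    have h3 : (SimpleGraph.Iso.comap (ballEquiv G r x) (ballGraph G r x)).symm.toHom
      (ballEquiv G r x i) = i := (ballEquiv G r x).symm_apply_apply i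
    rw [h3] at h2
    exact h2
  degree_le := hG.of_embedding
    ((SimpleGraph.Embedding.induce (ballSet G r x)).comp
      (SimpleGraph.Iso.comap (ballEquiv G r x) (ballGraph G r x)).toEmbedding)
  separating := hφ.of_embedding
    ((SimpleGraph.Embedding.induce (ballSet G r x)).comp
      (SimpleGraph.Iso.comap (ballEquiv G r x) (ballGraph G r x)).toEmbedding)

/-- The class of the labeled ball does not depend on the enumeration: two such classes agree
exactly when the two labeled balls are isomorphic. -/
theorem labeledBall_equiv_iff {V W Q : Type*} [Finite V] [Finite W] {G : SimpleGraph V}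
    {H : SimpleGraph W} {d k : ℕ} {φ : V → Q} {ψ : W → Q}
    (hG : DegreeBounded G d) (hφ : IsSeparating G k φ)
    (hH : DegreeBounded H d) (hψ : IsSeparating H k ψ) (r : ℕ) (x : V) (y : W) :
    (Quotient.mk _ (labeledBall hG hφ r x) : BallType d r k Q) =
        Quotient.mk _ (labeledBall hH hψ r y) ↔
      ∃ e : ballGraph G r x ≃g ballGraph H r y,
        e ⟨x, mem_ballSet_self G r x⟩ = ⟨y, mem_ballSet_self H r y⟩ ∧
          ∀ z, ψ (e z) = φ z := by
  let a := SimpleGraph.Iso.comap (ballEquiv G r x) (ballGraph G r x)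
  let b := SimpleGraph.Iso.comap (ballEquiv H r y) (ballGraph H r y)
  rw [Quotient.eq]
  constructor
  · rintro ⟨e, h1, h2⟩
    refine ⟨(b.comp e).comp a.symm, ?_, fun z => ?_⟩
    · exact (congrArg b h1).trans ((ballEquiv H r y).apply_symm_apply _)
    · exact (h2 (a.symm z)).trans (congrArg (fun w : ballSet G r x => φ w) (a.apply_symm_apply z))
  · rintro ⟨e, h1, h2⟩
    refine ⟨(b.symm.comp e).comp a, ?_, fun z => ?_⟩
    · refine congrArg b.symm (Eq.trans ?_ h1)
      exact congrArg e ((ballEquiv G r x).apply_symm_apply _)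
    · exact (congrArg (fun w : ballSet H r y => ψ w) (b.apply_symm_apply (e (a z)))).trans
        (h2 (a z))

/-- The operator `O_Θ` of an `r`-round algorithm with oracle `Θ`: the output at `x` is the value
of `Θ` at the isomorphism class of the labeled ball of radius `r` around `x`. -/
noncomputable def run {V N Q : Type*} [Finite V] {d r k : ℕ} (Θ : BallType d r k N → Q)
    {G : SimpleGraph V} (hG : DegreeBounded G d) {φ : V → N} (hφ : IsSeparating G k φ) : V → Q :=
  fun x => Θ (Quotient.mk _ (labeledBall hG hφ r x))

/-- Matching functions: every vertex `a` shares its label with at most one other vertex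
within distance `5`, and such a vertex is a neighbour of `a`. -/
structure IsMatchingFunction {V Q : Type*} (G : SimpleGraph V) (ρ : V → Q) : Prop where
  unique : ∀ a b c, 0 < G.edist a b → G.edist a b ≤ 5 → ρ a = ρ b →
    0 < G.edist a c → G.edist a c ≤ 5 → ρ a = ρ c → b = c
  adj : ∀ a b, 0 < G.edist a b → G.edist a b ≤ 5 → ρ a = ρ b → G.Adj a b

/-- The subgraph `M_ρ` formed by the edges of `G` whose endpoints have the same `ρ`-label. -/
def matchingOf {V Q : Type*} (G : SimpleGraph V) (ρ : V → Q) : G.Subgraph where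
  verts := {a | ∃ b, G.Adj a b ∧ ρ a = ρ b}
  Adj a b := G.Adj a b ∧ ρ a = ρ b
  adj_sub h := h.1
  edge_vert {_ b} h := ⟨b, h⟩
  symm := ⟨fun _ _ h => ⟨h.1.symm, h.2.symm⟩⟩

/-- The maximum number of edges of a matching of `G` (used for finite `G` only). -/
noncomputable def matchingNumber {V : Type*} (G : SimpleGraph V) : ℕ :=
  sSup {m | ∃ M : G.Subgraph, M.IsMatching ∧ M.edgeSet.ncard = m}

/-- For a finite graph the maximum is attained by a matching. -/
theorem matchingNumber_isGreatest {V : Type*} [Finite V] (G : SimpleGraph V) :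
    IsGreatest {m | ∃ M : G.Subgraph, M.IsMatching ∧ M.edgeSet.ncard = m}
      (matchingNumber G) := by
  have hb : BddAbove {m | ∃ M : G.Subgraph, M.IsMatching ∧ M.edgeSet.ncard = m} := by
    refine ⟨G.edgeSet.ncard, ?_⟩
    rintro _ ⟨M, -, rfl⟩
    exact Set.ncard_le_ncard M.edgeSet_subset (Set.toFinite _)
  have hn : {m | ∃ M : G.Subgraph, M.IsMatching ∧ M.edgeSet.ncard = m}.Nonempty :=
    ⟨_, ⊥, fun _ hv => hv.elim, rfl⟩
  exact ⟨Nat.sSup_mem hn hb, fun _ hm => le_csSup hb hm⟩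

end LocalMatching

/-!
A separating labeling identifies a vertex within its surroundings by its label. Hence a matching can
be stored by letting each vertex name the label of its partner, and an improvement of a matching on
at most `K` vertices is a *pattern*, a piece of data about labels. There are finitely many patterns.
Distinct occurrences of the same pattern do not meet, so a local rule can carry out the improvement
at all of them simultaneously. A *sweep* does so for one pattern after the other.

In the union of a maximum matching and the current one all degrees are at most two, while a
component with `c` vertices has at least `c - 1` edges; so the two matchings together miss at most
two vertices of it. If the component has at most `K` vertices and the next sweep does not touch it,
then the current matching misses no more of its vertices than the maximum one, as otherwise the
exchange of the two would be a pattern occurring there. The exceptional components are few: at most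
`|V| / K` of them have more than `K` vertices, and since a sweep which touches `s` vertices reduces
the number of unmatched vertices by at least `s / K`, one of the first `K ^ 2` sweeps touches at
most `|V| / K` vertices. Thus after `K ^ 2` sweeps at most `2 |V| / K` edges are missing.
-/

namespace LocalMatching

open scoped Finset

universe u

variable {V W U N X Y Z : Type*} {G : SimpleGraph V} {H : SimpleGraph W} {d k r n : ℕ}

theorem edist_le_add {x y z : V} {a b : ℕ} (hxy : G.edist x y ≤ a) (hyz : G.edist y z ≤ b) :
    G.edist x z ≤ (a + b : ℕ) := by
  push_cast
  exact SimpleGraph.edist_triangle.trans (add_le_add hxy hyz)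

theorem edist_le_of_adj {x y : V} (h : G.Adj x y) (hk : 1 ≤ k) : G.edist x y ≤ k :=
  (SimpleGraph.edist_eq_one_iff_adj.2 h).le.trans (by exact_mod_cast hk)

theorem edist_le_succ_iff {x z : V} :
    G.edist x z ≤ (k + 1 : ℕ) ↔ x = z ∨ ∃ y, G.Adj x y ∧ G.edist y z ≤ k := by
  constructor
  · intro h
    obtain ⟨p, hp⟩ := SimpleGraph.exists_walk_of_edist_ne_top
      (ne_top_of_le_ne_top (ENat.natCast_ne_top (k + 1)) h)
    rw [← hp, Nat.cast_le] at h
    cases p with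
    | nil => exact Or.inl rfl
    | cons hxy p =>
      rw [SimpleGraph.Walk.length_cons] at h
      exact Or.inr ⟨_, hxy, (SimpleGraph.edist_le p).trans (by exact_mod_cast (by omega))⟩
  · rintro (rfl | ⟨y, hxy, hyz⟩)
    · simp
    · rw [add_comm]
      exact edist_le_add (edist_le_of_adj hxy le_rfl) hyz

theorem ballSet_succ (x : V) :
    ballSet G (r + 1) x = insert x (⋃ y ∈ G.neighborSet x, ballSet G r y) := by
  ext z
  simp only [ballSet, Set.mem_ofPred_eq, edist_le_succ_iff, Set.mem_insert_iff, Set.mem_iUnion,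
    SimpleGraph.mem_neighborSet, exists_prop, eq_comm]

theorem DegreeBounded.encard_ballSet_le (hG : DegreeBounded G d) (r : ℕ) (x : V) :
    (ballSet G r x).encard ≤ ((d + 1) ^ r : ℕ) := by
  induction r generalizing x with
  | zero => simp [ballSet, SimpleGraph.edist_eq_zero_iff]
  | succ r ih =>
    have hfin : (G.neighborSet x).Finite := Set.finite_of_encard_le_coe (hG x)
    have hdeg : hfin.toFinset.card ≤ d := by
      have h := hG x
      rwa [hfin.encard_eq_coe_toFinset_card, Nat.cast_le] at h
    calc (ballSet G (r + 1) x).encard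
        ≤ (⋃ y ∈ hfin.toFinset, ballSet G r y).encard + 1 := by
          simpa only [ballSet_succ, Set.Finite.mem_toFinset] using Set.encard_insert_le _ _
      _ ≤ ∑ y ∈ hfin.toFinset, (ballSet G r y).encard + 1 := by
          gcongr
          exact Finset.set_encard_biUnion_le _ _
      _ ≤ (d * (d + 1) ^ r + 1 : ℕ) := by
          rw [Nat.cast_add, Nat.cast_one]
          gcongr
          refine (Finset.sum_le_card_nsmul _ _ _ fun y _ => ih y).trans ?_
          rw [nsmul_eq_mul]
          exact_mod_cast Nat.mul_le_mul_right _ hdeg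
      _ ≤ ((d + 1) ^ (r + 1) : ℕ) := by
          rw [Nat.cast_le, pow_succ', add_one_mul]
          exact Nat.add_le_add_left (Nat.one_le_pow _ _ d.succ_pos) _

theorem isLarge_of_pow_le_card (h : (d + 1) ^ k ≤ Nat.card N) : IsLarge k d N := by
  intro B
  have huniv : ballSet B.graph k B.root = Set.univ := Set.eq_univ_of_forall B.edist_le
  have hball := B.degree_le.encard_ballSet_le k B.root
  rw [huniv, Set.encard_univ, ENat.card_eq_coe_fintype_card, Fintype.card_fin, Nat.cast_le] at hball
  exact hball.trans h

theorem IsSeparating.mono {φ : V → N} (hφ : IsSeparating G n φ) (hkn : k ≤ n) :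
    IsSeparating G k φ :=
  fun x y hpos hk => hφ x y hpos (hk.trans (by exact_mod_cast hkn))

theorem IsSeparating.eq_of_edist_le {φ : V → N} (hφ : IsSeparating G k φ) {x y : V}
    (hxy : G.edist x y ≤ k) (h : φ x = φ y) : x = y := by
  by_contra hne
  exact hφ x y (SimpleGraph.edist_pos_of_ne hne) hxy h

theorem IsSeparating.ne_of_adj {φ : V → N} (hφ : IsSeparating G 1 φ) {x y : V}
    (hxy : G.Adj x y) : φ x ≠ φ y :=
  fun h => hxy.ne (hφ.eq_of_edist_le (edist_le_of_adj hxy le_rfl) h)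

theorem IsSeparating.eq_of_adj_of_adj {φ : V → N} (hφ : IsSeparating G 2 φ) {x y z : V}
    (hxy : G.Adj x y) (hxz : G.Adj x z) (h : φ y = φ z) : y = z :=
  hφ.eq_of_edist_le
    (edist_le_add (edist_le_of_adj hxy.symm le_rfl) (edist_le_of_adj hxz le_rfl)) h

section Locality

/-- Two vertices of labeled graphs are `r`-bisimilar if `r` rounds of message passing cannot
distinguish them: their labels agree, and in each round the neighbours of one are matched by
neighbours of the other, in both directions. -/
def Bisimilar (G : SimpleGraph V) (φ : V → N) (H : SimpleGraph W) (ψ : W → N) :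
    ℕ → V → W → Prop
  | 0, x, y => φ x = ψ y
  | r + 1, x, y => Bisimilar G φ H ψ r x y ∧
      (∀ x', G.Adj x x' → ∃ y', H.Adj y y' ∧ Bisimilar G φ H ψ r x' y') ∧
      (∀ y', H.Adj y y' → ∃ x', G.Adj x x' ∧ Bisimilar G φ H ψ r x' y')

namespace Bisimilar

variable {F : SimpleGraph U} {φ : V → N} {ψ : W → N} {χ : U → N}

theorem mono {s : ℕ} (hrs : r ≤ s) {x : V} {y : W} (h : Bisimilar G φ H ψ s x y) :
    Bisimilar G φ H ψ r x y := by
  induction s, hrs using Nat.le_induction with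
  | base => exact h
  | succ s _ ih => exact ih h.1

theorem trans {x : V} {y : W} {z : U} (hxy : Bisimilar G φ H ψ r x y)
    (hyz : Bisimilar H ψ F χ r y z) : Bisimilar G φ F χ r x z := by
  induction r generalizing x y z with
  | zero => exact Eq.trans hxy hyz
  | succ r ih =>
    refine ⟨ih hxy.1 hyz.1, fun x' hx => ?_, fun z' hz => ?_⟩
    · obtain ⟨y', hy, hxy'⟩ := hxy.2.1 x' hx
      obtain ⟨z', hz, hyz'⟩ := hyz.2.1 y' hy
      exact ⟨z', hz, ih hxy' hyz'⟩
    · obtain ⟨y', hy, hyz'⟩ := hyz.2.2 z' hz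
      obtain ⟨x', hx, hxy'⟩ := hxy.2.2 y' hy
      exact ⟨x', hx, ih hxy' hyz'⟩

theorem of_iso (e : G ≃g H) (he : ∀ x, ψ (e x) = φ x) (r : ℕ) (x : V) :
    Bisimilar G φ H ψ r x (e x) := by
  induction r generalizing x with
  | zero => exact (he x).symm
  | succ r ih =>
    refine ⟨ih x, fun x' hx => ⟨e x', e.map_adj_iff.2 hx, ih x'⟩, fun y' hy => ?_⟩
    obtain ⟨x', rfl⟩ := e.surjective y'
    exact ⟨x', e.map_adj_iff.1 hy, ih x'⟩

theorem of_induce {S : Set V} (x : S) (hS : ballSet G r x ⊆ S) :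
    Bisimilar (G.induce S) (fun y => φ y) G φ r x (x : V) := by
  induction r generalizing x with
  | zero => rfl
  | succ r ih =>
    have hself : ballSet G r x ⊆ S := fun y hy =>
      hS (show G.edist x y ≤ (r + 1 : ℕ) from le_trans hy (by exact_mod_cast r.le_succ))
    rw [ballSet_succ] at hS
    have hnbr : ∀ y ∈ G.neighborSet x, ballSet G r y ⊆ S := fun y hy =>
      (Set.subset_biUnion_of_mem (u := fun y => ballSet G r y) hy).trans
        ((Set.subset_insert _ _).trans hS)
    refine ⟨ih x hself, fun x' hx => ⟨x', hx, ih x' (hnbr x' hx)⟩, fun y hy => ?_⟩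
    exact ⟨⟨y, hnbr y hy (mem_ballSet_self G r y)⟩, hy, ih _ (hnbr y hy)⟩

end Bisimilar

/-- A rule producing a vertex labeling of every `N`-labeled graph. -/
abbrev Rule (N X : Type*) := ∀ V : Type u, SimpleGraph V → (V → N) → V → X

namespace Rule

/-- A rule is local if boundedly many rounds of message passing determine its value at a vertex;
the number of rounds does not depend on the graph. -/
def IsLocal (A : Rule.{u} N X) : Prop :=
  ∃ r : ℕ, ∀ (V W : Type u) (G : SimpleGraph V) (H : SimpleGraph W) (φ : V → N) (ψ : W → N)
    (x : V) (y : W), Bisimilar G φ H ψ r x y → A V G φ x = A W H ψ y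

/-- The value of a rule at the root of a labeled ball. The enumerated vertex set of the ball has to
be lifted to the universe in which the rule operates. -/
def evalBall (A : Rule.{u} N X) (B : LabeledBall d r k N) : X :=
  A (ULift (Fin B.size)) (B.graph.comap ULift.down) (B.label ∘ ULift.down) ⟨B.root⟩

namespace IsLocal

variable {A : Rule.{u} N X} {B : Rule.{u} N Y}

theorem label : IsLocal.{u} (N := N) fun _ _ φ x => φ x :=
  ⟨0, fun _ _ _ _ _ _ _ _ h => h⟩

theorem map (hA : A.IsLocal) (F : X → Y) : IsLocal.{u} fun V G φ x => F (A V G φ x) := by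
  obtain ⟨r, hr⟩ := hA
  exact ⟨r, fun V W G H φ ψ x y h => congrArg F (hr V W G H φ ψ x y h)⟩

theorem map₂ (hA : A.IsLocal) (hB : B.IsLocal) (F : X → Y → Z) :
    IsLocal.{u} fun V G φ x => F (A V G φ x) (B V G φ x) := by
  obtain ⟨r, hr⟩ := hA
  obtain ⟨s, hs⟩ := hB
  exact ⟨max r s, fun V W G H φ ψ x y h =>
    congrArg₂ F (hr V W G H φ ψ x y (h.mono (le_max_left r s)))
      (hs V W G H φ ψ x y (h.mono (le_max_right r s)))⟩

theorem pi {ι : Type*} [Finite ι] {A : ι → Rule.{u} N X} (hA : ∀ i, (A i).IsLocal) :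
    IsLocal.{u} fun V G φ x i => A i V G φ x := by
  choose r hr using hA
  obtain ⟨s, hs⟩ := Finite.exists_le r
  exact ⟨s, fun V W G H φ ψ x y h => funext fun i => hr i V W G H φ ψ x y (h.mono (hs i))⟩

theorem exists_adj (hA : A.IsLocal) (hB : B.IsLocal) (F : X → Y → Prop) :
    IsLocal.{u} fun V G φ x => ∃ z : V, G.Adj x z ∧ F (A V G φ x) (B V G φ z) := by
  obtain ⟨r, hr⟩ := hA
  obtain ⟨s, hs⟩ := hB
  refine ⟨max r s + 1, fun V W G H φ ψ x y h => ?_⟩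
  simp only [hr V W G H φ ψ x y (h.1.mono (le_max_left r s))]
  refine propext ⟨fun ⟨z, hz, hF⟩ => ?_, fun ⟨w, hw, hF⟩ => ?_⟩
  · obtain ⟨w, hw, hzw⟩ := h.2.1 z hz
    exact ⟨w, hw, by rwa [← hs V W G H φ ψ z w (hzw.mono (le_max_right r s))]⟩
  · obtain ⟨z, hz, hzw⟩ := h.2.2 w hw
    exact ⟨z, hz, by rwa [hs V W G H φ ψ z w (hzw.mono (le_max_right r s))]⟩

theorem exists_near {A : Rule.{u} N Prop} (hA : A.IsLocal) (t : ℕ) :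
    IsLocal.{u} fun V G φ x => ∃ z : V, G.edist x z ≤ t ∧ A V G φ z := by
  induction t with
  | zero => simpa [SimpleGraph.edist_eq_zero_iff] using hA
  | succ t ih =>
    have h := hA.map₂ (label.exists_adj ih fun _ Q => Q) Or
    convert h using 5 with V G φ x
    simp only [edist_le_succ_iff, or_and_right, exists_or, exists_eq_left', ← exists_and_right,
      ← exists_and_left, and_assoc]
    rw [exists_comm]

theorem forall_near {A : Rule.{u} N Prop} (hA : A.IsLocal) (t : ℕ) :
    IsLocal.{u} fun V G φ x => ∀ z : V, G.edist x z ≤ t → A V G φ z := by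
  have h := ((hA.map Not).exists_near t).map Not
  simpa only [not_exists, not_and, not_not] using h

theorem evalBall_eq_of_equiv (hA : A.IsLocal) {B C : LabeledBall d r k N} (h : B ≈ C) :
    A.evalBall B = A.evalBall C := by
  obtain ⟨s, hs⟩ := hA
  obtain ⟨e, hroot, hlabel⟩ := h
  let b := SimpleGraph.Iso.comap Equiv.ulift.{u} B.graph
  let c := SimpleGraph.Iso.comap Equiv.ulift.{u} C.graph
  refine hs _ _ _ _ _ _ _ _ ?_
  have h := Bisimilar.of_iso (φ := B.label ∘ ULift.down) (ψ := C.label ∘ ULift.down)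
    ((c.symm.comp e).comp b) (fun z => hlabel z.down) s ⟨B.root⟩
  rwa [show (c.symm.comp e).comp b ⟨B.root⟩ = ⟨C.root⟩ from congrArg ULift.up hroot] at h

/-- The oracle which evaluates a local rule at the root of a ball. -/
def oracle (hA : A.IsLocal) (d r k : ℕ) : BallType d r k N → X :=
  Quotient.lift A.evalBall fun _ _ => hA.evalBall_eq_of_equiv

theorem exists_run_eq (hA : A.IsLocal) (d n : ℕ) :
    ∃ l, n ≤ l ∧ ∃ Θ : BallType d l n N → X, ∀ (V : Type u) [Finite V] (G : SimpleGraph V)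
      (hG : DegreeBounded G d) (φ : V → N) (hφ : IsSeparating G n φ), run Θ hG hφ = A V G φ := by
  obtain ⟨r, hr⟩ := id hA
  refine ⟨max n r, le_max_left n r, hA.oracle d (max n r) n,
    fun V _ G hG φ hφ => funext fun x => ?_⟩
  set l := max n r
  let B := labeledBall hG hφ l x
  let e : B.graph.comap ULift.down ≃g ballGraph G l x :=
    (SimpleGraph.Iso.comap (ballEquiv G l x) (ballGraph G l x)).comp
      (SimpleGraph.Iso.comap Equiv.ulift.{u} B.graph)
  have hball : Bisimilar _ (B.label ∘ ULift.down) (ballGraph G l x) (fun y => φ y) l ⟨B.root⟩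
      (e ⟨B.root⟩) :=
    Bisimilar.of_iso (ψ := fun y : ballSet G l x => φ y) e (fun _ => rfl) l ⟨B.root⟩
  have hroot : e ⟨B.root⟩ = ⟨x, mem_ballSet_self G l x⟩ :=
    (ballEquiv G l x).apply_symm_apply _
  rw [hroot] at hball
  exact hr _ _ _ _ _ _ _ _ ((hball.trans (.of_induce _ subset_rfl)).mono (le_max_right n r))

end IsLocal

end Rule

end Locality

section PartnerLabeling

/-- The edges of `G` whose endpoints name each other: `f x` is the `φ`-label of `z` and `f z` is the
`φ`-label of `x`. If `φ` is `2`-separating, these edges form a matching. -/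
def partnerGraph (G : SimpleGraph V) (φ f : V → N) : SimpleGraph V where
  Adj x z := G.Adj x z ∧ f x = φ z ∧ f z = φ x
  symm := ⟨fun _ _ h => ⟨h.1.symm, h.2.2, h.2.1⟩⟩
  loopless := ⟨fun _ h => h.1.ne rfl⟩

/-- A partner labeling codes a matching by letting every matched vertex name the `φ`-label of its
partner; an unmatched vertex names its own label. -/
def IsPartnerLabeling (G : SimpleGraph V) (φ f : V → N) : Prop :=
  ∀ x, f x = φ x ∨ ∃ z, (partnerGraph G φ f).Adj x z

open scoped Classical in
/-- The vertices left unmatched by the matching which `f` codes. -/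
noncomputable def unmatched [Fintype V] (φ f : V → N) : Finset V := {x | f x = φ x}

variable {φ f g : V → N}

theorem mem_unmatched [Fintype V] {x : V} : x ∈ unmatched φ f ↔ f x = φ x := by simp [unmatched]

theorem partnerGraph_le : partnerGraph G φ f ≤ G := fun _ _ h => h.1

theorem ne_of_partnerGraph_adj (hφ : IsSeparating G 1 φ) {x z : V}
    (h : (partnerGraph G φ f).Adj x z) : f x ≠ φ x :=
  fun hx => hφ.ne_of_adj h.1 (hx.symm.trans h.2.1)

theorem eq_of_partnerGraph_adj (hφ : IsSeparating G 2 φ) {x y z : V}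
    (hxy : (partnerGraph G φ f).Adj x y) (hxz : (partnerGraph G φ f).Adj x z) : y = z :=
  hφ.eq_of_adj_of_adj hxy.1 hxz.1 (hxy.2.1.symm.trans hxz.2.1)

open scoped Classical in
theorem degree_partnerGraph_add_le [Fintype V] (hφ : IsSeparating G 2 φ) (x : V) :
    (partnerGraph G φ f).degree x + (if f x = φ x then 1 else 0) ≤ 1 := by
  rw [← SimpleGraph.card_neighborFinset_eq_degree]
  split_ifs with hx
  · have hempty : (partnerGraph G φ f).neighborFinset x = ∅ :=
      Finset.eq_empty_of_forall_notMem fun z hz =>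
        ne_of_partnerGraph_adj (hφ.mono one_le_two) (by simpa using hz) hx
    rw [hempty, Finset.card_empty]
  · refine Finset.card_le_one.2 fun y hy z hz => eq_of_partnerGraph_adj hφ (f := f) (x := x) ?_ ?_
    · simpa using hy
    · simpa using hz

open scoped Classical in
theorem degree_partnerGraph_sup_add_le [Fintype V] (hφ : IsSeparating G 2 φ) (x : V) :
    (partnerGraph G φ f ⊔ partnerGraph G φ g).degree x +
      ((if f x = φ x then 1 else 0) + if g x = φ x then 1 else 0) ≤ 2 := by
  have hf := degree_partnerGraph_add_le (f := f) hφ x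
  have hg := degree_partnerGraph_add_le (f := g) hφ x
  have hsup : (partnerGraph G φ f ⊔ partnerGraph G φ g).degree x ≤
      (partnerGraph G φ f).degree x + (partnerGraph G φ g).degree x := by
    simp only [← SimpleGraph.card_neighborFinset_eq_degree]
    rw [SimpleGraph.neighborFinset_sup]
    exact Finset.card_union_le _ _
  omega

end PartnerLabeling

open scoped Classical in
/-- A pattern is an improvement of a partner labeling on a set of at most `K` vertices, described
purely in terms of the labels `support` of these vertices: the vertex with label `c` is to rename
its partner from `old c` to `new c`, after which fewer vertices are unmatched. -/
structure Pattern (N : Type*) (K : ℕ) where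
  support : Finset N
  old : N → N
  new : N → N
  card_support_le : #support ≤ K
  old_mem : ∀ c ∈ support, old c ∈ support
  new_mem : ∀ c ∈ support, new c ∈ support
  new_new : ∀ c ∈ support, new (new c) = c
  card_lt : #{c ∈ support | new c = c} < #{c ∈ support | old c = c}

namespace Pattern

variable {K : ℕ}

instance instFinite [Finite N] : Finite (Pattern N K) :=
  Finite.of_injective (fun p => (p.support, p.old, p.new)) fun p q h => by
    cases p
    cases q
    simp_all

/-- Around the vertex `y` the labeling `f` looks as described by the pattern: all labels of the
pattern occur nearby, `f` names the old partner of `y`, and the new partner is a neighbour. -/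
def Fits (p : Pattern N K) (G : SimpleGraph V) (φ f : V → N) (y : V) : Prop :=
  (∀ c ∈ p.support, ∃ z, G.edist y z ≤ K ∧ φ z = c) ∧ f y = p.old (φ y) ∧
    (p.new (φ y) = φ y ∨ ∃ z, G.Adj y z ∧ p.new (φ y) = φ z)

/-- The vertex `x` lies in an occurrence of the pattern, in the sense that the pattern fits around
all vertices near `x` which carry a label of the pattern. -/
def Active (p : Pattern N K) (G : SimpleGraph V) (φ f : V → N) (x : V) : Prop :=
  φ x ∈ p.support ∧ ∀ y, G.edist x y ≤ K → φ y ∈ p.support → p.Fits G φ f y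

open scoped Classical in
/-- The improvement described by the pattern, carried out at all its occurrences simultaneously. -/
noncomputable def update (p : Pattern N K) (G : SimpleGraph V) (φ f : V → N) : V → N :=
  fun x => if p.Active G φ f x then p.new (φ x) else f x

open scoped Classical in
/-- The vertices in occurrences of the pattern. -/
noncomputable def activeFinset [Fintype V] (p : Pattern N K) (G : SimpleGraph V) (φ f : V → N) :
    Finset V :=
  {x | p.Active G φ f x}

variable {p : Pattern N K} {φ f g : V → N}

theorem mem_activeFinset [Fintype V] {x : V} : x ∈ p.activeFinset G φ f ↔ p.Active G φ f x := by
  simp [activeFinset]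

theorem Active.fits {x : V} (hx : p.Active G φ f x) : p.Fits G φ f x :=
  hx.2 x (by simp) hx.1

theorem Active.of_edist_le (hφ : IsSeparating G (3 * K) φ) {x y : V} (hx : p.Active G φ f x)
    (hxy : G.edist x y ≤ K) (hy : φ y ∈ p.support) : p.Active G φ f y := by
  refine ⟨hy, fun z hyz hz => ?_⟩
  obtain ⟨z', hxz', hlabel⟩ := hx.fits.1 _ hz
  have hzz' : G.edist z' z ≤ (3 * K : ℕ) := by
    rw [show 3 * K = K + K + K by ring]
    exact edist_le_add (edist_le_add (SimpleGraph.edist_comm.trans_le hxz') hxy) hyz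
  obtain rfl : z' = z := hφ.eq_of_edist_le hzz' hlabel
  exact hx.2 z' hxz' hz

theorem isPartnerLabeling_update (hK : 0 < K) (hφ : IsSeparating G (3 * K) φ)
    (hf : IsPartnerLabeling G φ f) : IsPartnerLabeling G φ (p.update G φ f) := by
  intro x
  by_cases hx : p.Active G φ f x
  · simp only [update, if_pos hx]
    refine hx.fits.2.2.imp_right fun ⟨z, hxz, hz⟩ => ⟨z, hxz, ?_, ?_⟩
    · exact (if_pos hx).trans hz
    · have hzact : p.Active G φ f z :=
        hx.of_edist_le hφ (edist_le_of_adj hxz hK) (hz ▸ p.new_mem _ hx.1)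
      exact (if_pos hzact).trans (hz ▸ p.new_new _ hx.1)
  · simp only [update, if_neg hx]
    refine (hf x).imp_right fun ⟨z, hxz, hxlabel, hzlabel⟩ => ⟨z, hxz, ?_, ?_⟩
    · exact (if_neg hx).trans hxlabel
    · have hzact : ¬ p.Active G φ f z := fun hz =>
        hx (hz.of_edist_le hφ (edist_le_of_adj hxz.symm hK)
          (hzlabel ▸ hz.fits.2.1 ▸ p.old_mem _ hz.1))
      exact (if_neg hzact).trans hzlabel

section Locality

variable [Finite N] {F : Rule.{u} N N}

theorem isLocal_fits (p : Pattern N K) (hF : F.IsLocal) :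
    Rule.IsLocal.{u} fun V G φ (x : V) => p.Fits G φ (F V G φ) x := by
  have hlabel := Rule.IsLocal.label.{u} (N := N)
  have hsupport : Rule.IsLocal.{u} fun V G φ (x : V) =>
      ∀ c : N, c ∈ p.support → ∃ z, G.edist x z ≤ K ∧ φ z = c :=
    (Rule.IsLocal.pi fun c => ((hlabel.map (· = c)).exists_near K).map (c ∈ p.support → ·)).map
      fun P : N → Prop => ∀ c, P c
  have hold : Rule.IsLocal.{u} fun V G φ (x : V) => F V G φ x = p.old (φ x) :=
    hF.map₂ hlabel fun a c => a = p.old c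
  have hnew : Rule.IsLocal.{u} fun V G φ (x : V) =>
      p.new (φ x) = φ x ∨ ∃ z, G.Adj x z ∧ p.new (φ x) = φ z :=
    (hlabel.map fun c => p.new c = c).map₂ (hlabel.exists_adj hlabel fun a c => p.new a = c) Or
  exact hsupport.map₂ (hold.map₂ hnew And) And

theorem isLocal_active (p : Pattern N K) (hF : F.IsLocal) :
    Rule.IsLocal.{u} fun V G φ (x : V) => p.Active G φ (F V G φ) x := by
  have hmem := Rule.IsLocal.label.{u}.map (· ∈ p.support)
  exact hmem.map₂ ((hmem.map₂ (p.isLocal_fits hF) fun P Q => P → Q).forall_near K) And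

theorem isLocal_update (p : Pattern N K) (hF : F.IsLocal) :
    Rule.IsLocal.{u} fun V G φ => p.update G φ (F V G φ) := by
  classical
  have hpair := (p.isLocal_active hF).map₂ Rule.IsLocal.label fun P c => (P, p.new c)
  convert hpair.map₂ hF fun a b => if a.1 then a.2 else b using 5
  simp only [update]

end Locality

section Counting

variable [Fintype V]

open scoped Classical in
theorem card_active_fiber_le (hφ : IsSeparating G (3 * K) φ) (c : N) {c' : N}
    (hc' : c' ∈ p.support) :
    #{x ∈ p.activeFinset G φ f | φ x = c} ≤ #{x ∈ p.activeFinset G φ f | φ x = c'} := by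
  have hex : ∀ x ∈ p.activeFinset G φ f, ∃ z, G.edist x z ≤ K ∧ φ z = c' := fun x hx =>
    (mem_activeFinset.1 hx).fits.1 c' hc'
  choose! z hz using hex
  refine Finset.card_le_card_of_injOn z (fun x hx => ?_) fun x hx y hy hxy => ?_
  · rw [Finset.mem_coe, Finset.mem_filter] at hx ⊢
    obtain ⟨hdist, hlabel⟩ := hz x hx.1
    exact ⟨mem_activeFinset.2
      ((mem_activeFinset.1 hx.1).of_edist_le hφ hdist (hlabel ▸ hc')), hlabel⟩
  · rw [Finset.mem_coe, Finset.mem_filter] at hx hy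
    have hdist : G.edist x y ≤ (K + K : ℕ) := edist_le_add (hz x hx.1).1
      (SimpleGraph.edist_comm.trans_le (hxy ▸ (hz y hy.1).1))
    exact (hφ.mono (by omega)).eq_of_edist_le hdist (hx.2.trans hy.2.symm)

open scoped Classical in
theorem exists_card_filter_activeFinset_eq_mul (p : Pattern N K) (f : V → N)
    (hφ : IsSeparating G (3 * K) φ) :
    ∃ q : ℕ, ∀ P : N → Prop, #{x ∈ p.activeFinset G φ f | P (φ x)} =
      #{c ∈ p.support | P c} * q := by
  obtain ⟨q, hq⟩ : ∃ q, ∀ c ∈ p.support, #{x ∈ p.activeFinset G φ f | φ x = c} = q := by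
    rcases p.support.eq_empty_or_nonempty with h | ⟨c, hc⟩
    · exact ⟨0, by simp [h]⟩
    · exact ⟨_, fun c' hc' => (card_active_fiber_le hφ c' hc).antisymm
        (card_active_fiber_le hφ c hc')⟩
  refine ⟨q, fun P => ?_⟩
  have hmaps : Set.MapsTo φ ({x ∈ p.activeFinset G φ f | P (φ x)} : Finset V)
      ({c ∈ p.support | P c} : Finset N) := fun x hx => by
    rw [Finset.mem_coe, Finset.mem_filter] at hx ⊢
    exact ⟨(mem_activeFinset.1 hx.1).1, hx.2⟩
  rw [Finset.card_eq_sum_card_fiberwise hmaps, Finset.sum_const_nat (m := q)]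
  intro c hc
  rw [Finset.mem_filter] at hc
  rw [← hq c hc.1, Finset.filter_filter]
  congr 1
  refine Finset.filter_congr fun x _ => and_iff_right_of_imp ?_
  rintro rfl
  exact hc.2

open scoped Classical in
theorem card_unmatched_update_add (p : Pattern N K) (G : SimpleGraph V) (φ f : V → N) :
    #(unmatched φ (p.update G φ f)) + #{x ∈ p.activeFinset G φ f | p.old (φ x) = φ x} =
      #(unmatched φ f) + #{x ∈ p.activeFinset G φ f | p.new (φ x) = φ x} := by
  have hold : ({x ∈ p.activeFinset G φ f | p.old (φ x) = φ x} : Finset V) =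
      unmatched φ f ∩ p.activeFinset G φ f := by
    ext x
    simp only [Finset.mem_filter, Finset.mem_inter, mem_unmatched, mem_activeFinset,
      and_comm (a := f x = φ x)]
    exact and_congr_right fun hx => by rw [hx.fits.2.1]
  have hnew : ({x ∈ p.activeFinset G φ f | p.new (φ x) = φ x} : Finset V) =
      unmatched φ (p.update G φ f) ∩ p.activeFinset G φ f := by
    ext x
    simp only [Finset.mem_filter, Finset.mem_inter, mem_unmatched, mem_activeFinset,
      and_comm (b := p.Active G φ f x)]
    exact and_congr_right fun hx => by rw [update, if_pos hx]
  have hrest : unmatched φ (p.update G φ f) \ p.activeFinset G φ f =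
      unmatched φ f \ p.activeFinset G φ f := by
    ext x
    simp only [Finset.mem_sdiff, mem_unmatched, mem_activeFinset]
    exact and_congr_left fun hx => by rw [update, if_neg hx]
  rw [hold, hnew, ← Finset.card_inter_add_card_sdiff (unmatched φ f) (p.activeFinset G φ f),
    ← Finset.card_inter_add_card_sdiff (unmatched φ (p.update G φ f)) (p.activeFinset G φ f), hrest]
  ring

theorem card_activeFinset_add_le (p : Pattern N K) (f : V → N) (hφ : IsSeparating G (3 * K) φ) :
    #(p.activeFinset G φ f) + K * #(unmatched φ (p.update G φ f)) ≤ K * #(unmatched φ f) := by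
  classical
  obtain ⟨q, hq⟩ := p.exists_card_filter_activeFinset_eq_mul f hφ
  have hactive : #(p.activeFinset G φ f) = #p.support * q := by
    simpa only [Finset.filter_true] using hq fun _ => True
  have hunmatched := p.card_unmatched_update_add G φ f
  rw [hq fun c => p.old c = c, hq fun c => p.new c = c] at hunmatched
  have hgain : #(unmatched φ (p.update G φ f)) + q ≤ #(unmatched φ f) := by
    have hlt := Nat.mul_le_mul_right q p.card_lt
    rw [Nat.succ_mul] at hlt
    omega
  calc #(p.activeFinset G φ f) + K * #(unmatched φ (p.update G φ f))
      ≤ K * q + K * #(unmatched φ (p.update G φ f)) := by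
        rw [hactive]
        gcongr
        exact p.card_support_le
    _ = K * (#(unmatched φ (p.update G φ f)) + q) := by ring
    _ ≤ K * #(unmatched φ f) := Nat.mul_le_mul_left K hgain

end Counting

open scoped Classical in
/-- The replacement of `f` by `g` on a set `S` of vertices as a pattern. The function `s` recovers
the vertices of `S` from their labels. -/
noncomputable def ofSection (S : Finset V) (s : N → V) (hs : ∀ x ∈ S, s (φ x) = x) (hS : #S ≤ K)
    (hf : ∀ x ∈ S, ∃ z ∈ S, f x = φ z) (hg : ∀ x ∈ S, ∃ z ∈ S, g x = φ z ∧ g z = φ x)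
    (hlt : #{x ∈ S | g x = φ x} < #{x ∈ S | f x = φ x}) : Pattern N K where
  support := S.image φ
  old c := f (s c)
  new c := g (s c)
  card_support_le := Finset.card_image_le.trans hS
  old_mem := Finset.forall_mem_image.2 fun x hx => by
    obtain ⟨z, hz, hxz⟩ := hf x hx
    rw [hs x hx, hxz]
    exact Finset.mem_image_of_mem φ hz
  new_mem := Finset.forall_mem_image.2 fun x hx => by
    obtain ⟨z, hz, hxz, -⟩ := hg x hx
    rw [hs x hx, hxz]
    exact Finset.mem_image_of_mem φ hz
  new_new := Finset.forall_mem_image.2 fun x hx => by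
    obtain ⟨z, hz, hxz, hzx⟩ := hg x hx
    rw [hs x hx, hxz, hs z hz, hzx]
  card_lt := by
    have hcard (h : V → N) : #{c ∈ S.image φ | h (s c) = c} = #{x ∈ S | h x = φ x} := by
      have hinj : Set.InjOn φ S := fun x hx y hy hxy => by rw [← hs x hx, hxy, hs y hy]
      rw [Finset.filter_image, Finset.card_image_of_injOn
        (hinj.mono (Finset.coe_subset.2 (Finset.filter_subset _ _)))]
      exact congrArg _ (Finset.filter_congr fun x hx => by rw [hs x hx])
    simpa only [hcard] using hlt

open scoped Classical in
theorem active_ofSection {S : Finset V} {s : N → V} {h : V → N} (hφ : IsSeparating G (3 * K) φ)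
    (hs : ∀ x ∈ S, s (φ x) = x) (hS : #S ≤ K) (hf : ∀ x ∈ S, ∃ z ∈ S, f x = φ z)
    (hg : ∀ x ∈ S, ∃ z ∈ S, g x = φ z ∧ g z = φ x)
    (hlt : #{x ∈ S | g x = φ x} < #{x ∈ S | f x = φ x})
    (hdist : ∀ x ∈ S, ∀ y ∈ S, G.edist x y ≤ K) (hfh : ∀ x ∈ S, h x = f x)
    (hgadj : ∀ x ∈ S, g x = φ x ∨ ∃ z, G.Adj x z ∧ g x = φ z) {x : V} (hx : x ∈ S) :
    (ofSection S s hs hS hf hg hlt).Active G φ h x := by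
  refine ⟨Finset.mem_image_of_mem φ hx, fun y hxy hy => ?_⟩
  obtain ⟨y', hy', hlabel⟩ := Finset.mem_image.1 hy
  obtain rfl : y' = y := (hφ.mono (by omega)).eq_of_edist_le
    (edist_le_add (hdist y' hy' x hx) hxy) hlabel
  refine ⟨Finset.forall_mem_image.2 fun z hz => ⟨z, hdist y' hy' z hz, rfl⟩, ?_, ?_⟩
  · simpa only [ofSection, hs y' hy'] using hfh y' hy'
  · simpa only [ofSection, hs y' hy'] using hgadj y' hy'

end Pattern

section Components

variable [Fintype V]

theorem edist_lt_card {x y : V} (h : G.Reachable x y) : G.edist x y < Fintype.card V := by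
  obtain ⟨p, hp⟩ := h.exists_isPath
  exact (SimpleGraph.edist_le p).trans_lt (by exact_mod_cast hp.length_lt)

theorem two_mul_card_le_sum_degree_add_two [DecidableRel G.Adj] (h : G.Connected) :
    2 * Fintype.card V ≤ ∑ x, G.degree x + 2 := by
  have hedge := h.card_vert_le_card_edgeSet_add_one
  rw [Nat.card_eq_fintype_card, Nat.card_eq_fintype_card, ← SimpleGraph.edgeFinset_card] at hedge
  rw [SimpleGraph.sum_degrees_eq_twice_card_edges]
  omega

open scoped Classical in
theorem card_eq_sum_card_component (G : SimpleGraph V) (s : Finset V) :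
    #s = ∑ C : G.ConnectedComponent, #{x ∈ s | x ∈ C} :=
  Finset.card_eq_sum_card_fiberwise (f := G.connectedComponentMk) fun _ _ => Finset.mem_univ _

open scoped Classical in
theorem card_component (C : G.ConnectedComponent) : Fintype.card C = #{x | x ∈ C} :=
  Fintype.card_of_subtype _ (by simp)

open scoped Classical in
theorem edist_lt_card_component {C : G.ConnectedComponent} {x y : V} (hx : x ∈ C) (hy : y ∈ C) :
    G.edist x y < #{x | x ∈ C} := by
  rw [← card_component C]
  exact (edist_map_le C.toSimpleGraph_hom ⟨x, hx⟩ ⟨y, hy⟩).trans_lt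
    (edist_lt_card (C.connected_toSimpleGraph.preconnected _ _))

open scoped Classical in
theorem two_mul_card_component_le [DecidableRel G.Adj] (C : G.ConnectedComponent) :
    2 * #{x | x ∈ C} ≤ ∑ x with x ∈ C, G.degree x + 2 := by
  have hsum : ∑ x with x ∈ C, G.degree x = ∑ x : C, G.degree x :=
    Finset.sum_subtype _ (by simp) _
  rw [← card_component C, hsum]
  refine (two_mul_card_le_sum_degree_add_two C.connected_toSimpleGraph).trans ?_
  gcongr with x
  simp only [← SimpleGraph.card_neighborFinset_eq_degree]
  refine Finset.card_le_card_of_injOn Subtype.val (fun y hy => ?_) Subtype.val_injective.injOn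
  rw [Finset.mem_coe, SimpleGraph.mem_neighborFinset] at hy ⊢
  exact hy

variable {φ f g : V → N}

open scoped Classical in
theorem card_unmatched_component_add_le (hφ : IsSeparating G 2 φ)
    (C : (partnerGraph G φ f ⊔ partnerGraph G φ g).ConnectedComponent) :
    #{x ∈ unmatched φ f | x ∈ C} + #{x ∈ unmatched φ g | x ∈ C} ≤ 2 := by
  have hdegree := Finset.sum_le_sum (s := {x | x ∈ C}) fun x _ =>
    degree_partnerGraph_sup_add_le (f := f) (g := g) hφ x
  have hcard (h : V → N) : #{x ∈ unmatched φ h | x ∈ C} =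
      ∑ x with x ∈ C, if h x = φ x then 1 else 0 := by
    rw [← Finset.card_filter, Finset.filter_filter, unmatched, Finset.filter_filter]
    simp only [and_comm]
  rw [Finset.sum_add_distrib, Finset.sum_add_distrib, ← hcard f, ← hcard g, Finset.sum_const,
    smul_eq_mul] at hdegree
  have := two_mul_card_component_le C
  omega

end Components

section Sweep

variable {K : ℕ}

/-- One sweep: the updates of the patterns in a list, carried out one after the other. -/
noncomputable def sweep (G : SimpleGraph V) (φ : V → N) : List (Pattern N K) → (V → N) → V → N
  | [], f => f
  | p :: L, f => sweep G φ L (p.update G φ f)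

open scoped Classical in
/-- The vertices which lie in an occurrence of a pattern at the time of its update in a sweep. -/
noncomputable def touched [Fintype V] (G : SimpleGraph V) (φ : V → N) :
    List (Pattern N K) → (V → N) → Finset V
  | [], _ => ∅
  | p :: L, f => p.activeFinset G φ f ∪ touched G φ L (p.update G φ f)

variable {L : List (Pattern N K)} {φ f g : V → N}

theorem isLocal_sweep [Finite N] (L : List (Pattern N K)) {F : Rule.{u} N N} (hF : F.IsLocal) :
    Rule.IsLocal.{u} fun V G φ => sweep G φ L (F V G φ) := by
  induction L generalizing F with
  | nil => exact hF
  | cons p _ ih => exact ih (p.isLocal_update hF)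

theorem isLocal_iterate_sweep [Finite N] (L : List (Pattern N K)) (t : ℕ) :
    Rule.IsLocal.{u} fun V G φ => (sweep G φ L)^[t] φ := by
  induction t with
  | zero => exact Rule.IsLocal.label
  | succ t ih => simpa only [Function.iterate_succ_apply'] using isLocal_sweep L ih

theorem isPartnerLabeling_sweep (hK : 0 < K) (hφ : IsSeparating G (3 * K) φ)
    (hf : IsPartnerLabeling G φ f) : IsPartnerLabeling G φ (sweep G φ L f) := by
  induction L generalizing f with
  | nil => exact hf
  | cons _ _ ih => exact ih (Pattern.isPartnerLabeling_update hK hφ hf)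

theorem isPartnerLabeling_iterate_sweep (hK : 0 < K) (hφ : IsSeparating G (3 * K) φ) (t : ℕ) :
    IsPartnerLabeling G φ ((sweep G φ L)^[t] φ) := by
  induction t with
  | zero => exact fun _ => Or.inl rfl
  | succ t ih =>
    rw [Function.iterate_succ_apply']
    exact isPartnerLabeling_sweep hK hφ ih

variable [Fintype V]

theorem card_touched_add_le (L : List (Pattern N K)) (f : V → N) (hφ : IsSeparating G (3 * K) φ) :
    #(touched G φ L f) + K * #(unmatched φ (sweep G φ L f)) ≤ K * #(unmatched φ f) := by
  classical
  induction L generalizing f with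
  | nil => simp [touched, sweep]
  | cons p L ih =>
    have hp := p.card_activeFinset_add_le f hφ
    have hL := ih (p.update G φ f)
    have hunion := Finset.card_union_le (p.activeFinset G φ f) (touched G φ L (p.update G φ f))
    simp only [touched, sweep]
    omega

theorem exists_activeFinset_subset_touched {p : Pattern N K} (hp : p ∈ L) (f : V → N) :
    ∃ h : V → N, (∀ x ∉ touched G φ L f, h x = f x) ∧
      p.activeFinset G φ h ⊆ touched G φ L f := by
  classical
  induction L generalizing f with
  | nil => simp at hp
  | cons q L ih =>
    simp only [touched]
    rcases List.mem_cons.1 hp with rfl | hpL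
    · exact ⟨f, fun _ _ => rfl, Finset.subset_union_left⟩
    · obtain ⟨h, hagree, hsub⟩ := ih hpL (q.update G φ f)
      refine ⟨h, fun x hx => ?_, hsub.trans Finset.subset_union_right⟩
      rw [Finset.mem_union, not_or, Pattern.mem_activeFinset] at hx
      exact (hagree x hx.2).trans (if_neg hx.1)

open scoped Classical in
theorem exists_mem_touched_of_component (hφ : IsSeparating G (3 * K) φ) (hL : ∀ p, p ∈ L)
    (hf : IsPartnerLabeling G φ f) (hg : IsPartnerLabeling G φ g)
    (C : (partnerGraph G φ f ⊔ partnerGraph G φ g).ConnectedComponent) (hC : #{x | x ∈ C} ≤ K)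
    (hlt : #{x ∈ unmatched φ g | x ∈ C} < #{x ∈ unmatched φ f | x ∈ C}) :
    ∃ x ∈ touched G φ L f, x ∈ C := by
  set S : Finset V := {x | x ∈ C} with hSdef
  have hS {x : V} : x ∈ S ↔ x ∈ C := by simp [hSdef]
  have hdist : ∀ x ∈ S, ∀ y ∈ S, G.edist x y ≤ K := fun x hx y hy =>
    (SimpleGraph.edist_anti (sup_le partnerGraph_le partnerGraph_le)).trans
      ((edist_lt_card_component (hS.1 hx) (hS.1 hy)).le.trans (by exact_mod_cast hC))
  have hmem {x z : V} (hx : x ∈ S) (h : (partnerGraph G φ f ⊔ partnerGraph G φ g).Adj x z) :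
      z ∈ S := hS.2 (C.mem_supp_of_adj_mem_supp (hS.1 hx) h)
  have hfS : ∀ x ∈ S, ∃ z ∈ S, f x = φ z := fun x hx =>
    (hf x).elim (fun h => ⟨x, hx, h⟩) fun ⟨z, h⟩ => ⟨z, hmem hx (Or.inl h), h.2.1⟩
  have hgS : ∀ x ∈ S, ∃ z ∈ S, g x = φ z ∧ g z = φ x := fun x hx =>
    (hg x).elim (fun h => ⟨x, hx, h, h⟩) fun ⟨z, h⟩ => ⟨z, hmem hx (Or.inr h), h.2⟩
  have hgadj : ∀ x ∈ S, g x = φ x ∨ ∃ z, G.Adj x z ∧ g x = φ z := fun x _ =>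
    (hg x).imp_right fun ⟨z, h⟩ => ⟨z, h.1, h.2.1⟩
  have hcard (h : V → N) : #{x ∈ unmatched φ h | x ∈ C} = #{x ∈ S | h x = φ x} := by
    rw [unmatched, hSdef, Finset.filter_filter, Finset.filter_filter]
    simp only [and_comm]
  rw [hcard, hcard] at hlt
  obtain ⟨y, hy⟩ : ∃ y, y ∈ C := C.nonempty_supp
  have : Nonempty V := ⟨y⟩
  have hinj : Set.InjOn φ S := fun x hx z hz hxz =>
    (hφ.mono (by omega)).eq_of_edist_le (hdist x hx z hz) hxz
  let p := Pattern.ofSection S (Function.invFunOn φ S) (fun x hx => hinj.leftInvOn_invFunOn hx)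
    hC hfS hgS hlt
  obtain ⟨h, hagree, hsub⟩ := exists_activeFinset_subset_touched (G := G) (φ := φ) (hL p) f
  by_contra! htouched
  have hhf : ∀ x ∈ S, h x = f x := fun x hx => hagree x fun hxt => htouched x hxt (hS.1 hx)
  exact htouched y (hsub (Pattern.mem_activeFinset.2
    (Pattern.active_ofSection hφ _ hC hfS hgS hlt hdist hhf hgadj (hS.2 hy)))) hy

open scoped Classical in
theorem mul_card_unmatched_component_le (hφ : IsSeparating G (3 * K) φ) (hφ₂ : IsSeparating G 2 φ)
    (hL : ∀ p, p ∈ L) (hf : IsPartnerLabeling G φ f) (hg : IsPartnerLabeling G φ g)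
    (C : (partnerGraph G φ f ⊔ partnerGraph G φ g).ConnectedComponent) :
    K * #{x ∈ unmatched φ f | x ∈ C} ≤ K * #{x ∈ unmatched φ g | x ∈ C} +
      2 * (K * #{x ∈ touched G φ L f | x ∈ C} + #{x | x ∈ C}) := by
  rcases le_or_gt #{x ∈ unmatched φ f | x ∈ C} #{x ∈ unmatched φ g | x ∈ C} with hle | hlt
  · exact (Nat.mul_le_mul_left K hle).trans (Nat.le_add_right _ _)
  have htwo : #{x ∈ unmatched φ f | x ∈ C} ≤ 2 :=
    (Nat.le_add_right _ _).trans (card_unmatched_component_add_le (g := g) hφ₂ C)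
  have hK : K ≤ K * #{x ∈ touched G φ L f | x ∈ C} + #{x | x ∈ C} := by
    rcases le_or_gt #{x | x ∈ C} K with hC | hC
    · obtain ⟨x, hx, hxC⟩ := exists_mem_touched_of_component hφ hL hf hg C hC hlt
      have hpos : 0 < #{x ∈ touched G φ L f | x ∈ C} :=
        Finset.card_pos.2 ⟨x, Finset.mem_filter.2 ⟨hx, hxC⟩⟩
      exact (Nat.le_mul_of_pos_right K hpos).trans (Nat.le_add_right _ _)
    · exact hC.le.trans (Nat.le_add_left _ _)
  calc K * #{x ∈ unmatched φ f | x ∈ C} ≤ K * 2 := Nat.mul_le_mul_left K htwo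
    _ ≤ 2 * (K * #{x ∈ touched G φ L f | x ∈ C} + #{x | x ∈ C}) := by omega
    _ ≤ _ := Nat.le_add_left _ _

theorem mul_card_unmatched_le (hφ : IsSeparating G (3 * K) φ) (hφ₂ : IsSeparating G 2 φ)
    (hL : ∀ p, p ∈ L) (hf : IsPartnerLabeling G φ f) (hg : IsPartnerLabeling G φ g) :
    K * #(unmatched φ f) ≤
      K * #(unmatched φ g) + 2 * (K * #(touched G φ L f) + Fintype.card V) := by
  classical
  have hcard := card_eq_sum_card_component (partnerGraph G φ f ⊔ partnerGraph G φ g)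
  rw [← Finset.card_univ, hcard (unmatched φ f), hcard (unmatched φ g), hcard (touched G φ L f),
    hcard Finset.univ]
  simp only [Finset.mul_sum, ← Finset.sum_add_distrib]
  exact Finset.sum_le_sum fun C _ => mul_card_unmatched_component_le hφ hφ₂ hL hf hg C

theorem sum_card_touched_add_le (L : List (Pattern N K)) (hφ : IsSeparating G (3 * K) φ) (m : ℕ) :
    ∑ t ∈ Finset.range m, #(touched G φ L ((sweep G φ L)^[t] φ)) +
      K * #(unmatched φ ((sweep G φ L)^[m] φ)) ≤ K * Fintype.card V := by
  induction m with
  | zero => simpa using Nat.mul_le_mul_left K (Finset.card_le_univ (unmatched φ φ))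
  | succ m ih =>
    have hstep := card_touched_add_le L ((sweep G φ L)^[m] φ) hφ
    rw [Finset.sum_range_succ, Function.iterate_succ_apply']
    omega

theorem antitone_card_unmatched_iterate_sweep (hK : 0 < K) (hφ : IsSeparating G (3 * K) φ) :
    Antitone fun t => #(unmatched φ ((sweep G φ L)^[t] φ)) := by
  refine antitone_nat_of_succ_le fun t => Nat.le_of_mul_le_mul_left ?_ hK
  rw [Function.iterate_succ_apply']
  exact (Nat.le_add_left _ _).trans (card_touched_add_le L _ hφ)

theorem exists_mul_card_touched_le (hK : 0 < K) (L : List (Pattern N K))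
    (hφ : IsSeparating G (3 * K) φ) :
    ∃ t < K ^ 2, K * #(touched G φ L ((sweep G φ L)^[t] φ)) ≤ Fintype.card V := by
  have hsum : ∑ t ∈ Finset.range (K ^ 2), K * #(touched G φ L ((sweep G φ L)^[t] φ)) ≤
      ∑ _t ∈ Finset.range (K ^ 2), Fintype.card V := by
    rw [← Finset.mul_sum, Finset.sum_const, Finset.card_range, smul_eq_mul, sq K, mul_assoc, ← sq K]
    exact Nat.mul_le_mul_left K
      ((Nat.le_add_right _ _).trans (sum_card_touched_add_le L hφ (K ^ 2)))
  obtain ⟨t, ht, hle⟩ := Finset.exists_le_of_sum_le ⟨0, Finset.mem_range.2 (pow_pos hK 2)⟩ hsum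
  exact ⟨t, Finset.mem_range.1 ht, hle⟩

theorem mul_card_unmatched_iterate_sweep_le (hK : 0 < K) (hφ : IsSeparating G (3 * K) φ)
    (hφ₂ : IsSeparating G 2 φ) (hL : ∀ p, p ∈ L) (hg : IsPartnerLabeling G φ g) :
    K * #(unmatched φ ((sweep G φ L)^[K ^ 2] φ)) ≤
      K * #(unmatched φ g) + 4 * Fintype.card V := by
  obtain ⟨t, ht, htouched⟩ := exists_mul_card_touched_le hK L hφ
  have hgap := mul_card_unmatched_le hφ hφ₂ hL
    (isPartnerLabeling_iterate_sweep (L := L) hK hφ t) hg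
  have hanti := Nat.mul_le_mul_left K (antitone_card_unmatched_iterate_sweep (L := L) hK hφ ht.le)
  dsimp only at hanti
  omega

end Sweep

section Matching

theorem ncard_verts_of_isMatching [Finite V] {M : G.Subgraph} (hM : M.IsMatching) :
    M.verts.ncard = 2 * M.edgeSet.ncard := by
  classical
  have := Fintype.ofFinite V
  have hdegree (v : V) : M.spanningCoe.degree v = if v ∈ M.verts then 1 else 0 := by
    rw [SimpleGraph.Subgraph.degree_spanningCoe]
    split_ifs with hv
    · exact SimpleGraph.Subgraph.isMatching_iff_forall_degree.1 hM v hv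
    · exact SimpleGraph.Subgraph.degree_of_notMem_verts hv
  have hsum := M.spanningCoe.sum_degrees_eq_twice_card_edges
  simp only [hdegree, ← Finset.card_filter] at hsum
  rw [SimpleGraph.edgeFinset, ← Set.ncard_eq_toFinset_card',
    SimpleGraph.Subgraph.edgeSet_spanningCoe] at hsum
  rw [← hsum, Set.ncard_eq_toFinset_card']
  congr 1
  ext v
  simp

variable {φ f : V → N}

theorem card_unmatched_add [Fintype V] {M : G.Subgraph} (hM : M.IsMatching)
    (hverts : ∀ x, x ∈ M.verts ↔ f x ≠ φ x) :
    #(unmatched φ f) + 2 * M.edgeSet.ncard = Fintype.card V := by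
  classical
  have hmatched : M.verts.toFinset = (unmatched φ f)ᶜ := by
    ext x
    simp [hverts, mem_unmatched]
  rw [← ncard_verts_of_isMatching hM, Set.ncard_eq_toFinset_card', hmatched, Finset.card_compl]
  exact Nat.add_sub_of_le (Finset.card_le_univ _)

theorem exists_isPartnerLabeling_of_isMatching [Fintype V] (hφ : IsSeparating G 1 φ)
    {M : G.Subgraph} (hM : M.IsMatching) :
    ∃ g : V → N, IsPartnerLabeling G φ g ∧
      #(unmatched φ g) + 2 * M.edgeSet.ncard = Fintype.card V := by
  have hex (x : V) : ∃ c, (x ∉ M.verts ∧ c = φ x) ∨ ∃ z, M.Adj x z ∧ c = φ z := by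
    by_cases hx : x ∈ M.verts
    · obtain ⟨z, hz, -⟩ := hM hx
      exact ⟨φ z, Or.inr ⟨z, hz, rfl⟩⟩
    · exact ⟨φ x, Or.inl ⟨hx, rfl⟩⟩
  choose g hg using hex
  have hpartner {x z : V} (hxz : M.Adj x z) : g x = φ z := by
    rcases hg x with ⟨hx, -⟩ | ⟨w, hxw, hgx⟩
    · exact (hx hxz.fst_mem).elim
    · rw [hgx, hM.eq_of_adj_left hxw hxz]
  refine ⟨g, fun x => ?_, card_unmatched_add hM fun x => ⟨fun hx => ?_, fun hne => ?_⟩⟩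
  · exact (hg x).imp And.right
      fun ⟨z, hxz, _⟩ => ⟨z, hxz.adj_sub, hpartner hxz, hpartner hxz.symm⟩
  · obtain ⟨z, hxz, -⟩ := hM hx
    exact fun hgx => hφ.ne_of_adj hxz.adj_sub (hgx.symm.trans (hpartner hxz))
  · by_contra hx
    exact (hg x).elim (fun h => hne h.2) fun ⟨_, hxz, _⟩ => hx hxz.fst_mem

/-- The pair of labels of the matching edge at `x`, as a vertex labeling; at an unmatched vertex it
is a diagonal pair. -/
def edgeLabel (φ f : V → N) (x : V) : Sym2 N := s(φ x, f x)

theorem isLocal_edgeLabel_iterate_sweep [Finite N] {K : ℕ} (L : List (Pattern N K)) (t : ℕ) :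
    Rule.IsLocal.{u} fun _ G φ => edgeLabel φ ((sweep G φ L)^[t] φ) :=
  Rule.IsLocal.label.map₂ (isLocal_iterate_sweep L t) fun a b => s(a, b)

theorem partnerGraph_adj_of_edgeLabel_eq (hφ : IsSeparating G 6 φ) (hf : IsPartnerLabeling G φ f)
    {a b : V} (hpos : 0 < G.edist a b) (hdist : G.edist a b ≤ 5)
    (h : edgeLabel φ f a = edgeLabel φ f b) : (partnerGraph G φ f).Adj a b := by
  have hne : φ a ≠ φ b := hφ.mono (by omega : 5 ≤ 6) a b hpos hdist
  obtain ⟨hab, -⟩ | ⟨hab, -⟩ := Sym2.eq_iff.1 h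
  · exact (hne hab).elim
  rcases hf b with hb | ⟨z, hbz⟩
  · exact (hne (hab.trans hb)).elim
  · obtain rfl : a = z := hφ.eq_of_edist_le
      (edist_le_add (b := 1) hdist (edist_le_of_adj hbz.1 le_rfl)) (hab.trans hbz.2.1)
    exact hbz.symm

theorem isMatchingFunction_edgeLabel (hφ : IsSeparating G 6 φ) (hf : IsPartnerLabeling G φ f) :
    IsMatchingFunction G (edgeLabel φ f) where
  unique _ _ _ hab hab' hablabel hac hac' haclabel :=
    eq_of_partnerGraph_adj (hφ.mono (by omega))
      (partnerGraph_adj_of_edgeLabel_eq hφ hf hab hab' hablabel)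
      (partnerGraph_adj_of_edgeLabel_eq hφ hf hac hac' haclabel)
  adj _ _ hpos hdist h := (partnerGraph_adj_of_edgeLabel_eq hφ hf hpos hdist h).1

theorem matchingOf_edgeLabel_adj (hφ : IsSeparating G 6 φ) (hf : IsPartnerLabeling G φ f)
    {a b : V} : (matchingOf G (edgeLabel φ f)).Adj a b ↔ (partnerGraph G φ f).Adj a b := by
  refine ⟨fun ⟨hab, h⟩ => ?_, fun ⟨hab, ha, hb⟩ => ⟨hab, ?_⟩⟩
  · exact partnerGraph_adj_of_edgeLabel_eq hφ hf (SimpleGraph.edist_pos_of_ne hab.ne)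
      (edist_le_of_adj (k := 5) hab (by omega)) h
  · rw [edgeLabel, edgeLabel, ha, hb, Sym2.eq_swap]

theorem isMatching_matchingOf_edgeLabel (hφ : IsSeparating G 6 φ) (hf : IsPartnerLabeling G φ f) :
    (matchingOf G (edgeLabel φ f)).IsMatching := by
  rintro a ⟨b, hab⟩
  exact ⟨b, hab, fun c hac => eq_of_partnerGraph_adj (hφ.mono (by omega))
    ((matchingOf_edgeLabel_adj hφ hf).1 hac) ((matchingOf_edgeLabel_adj hφ hf).1 hab)⟩

theorem mem_verts_matchingOf_edgeLabel (hφ : IsSeparating G 6 φ) (hf : IsPartnerLabeling G φ f)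
    (x : V) : x ∈ (matchingOf G (edgeLabel φ f)).verts ↔ f x ≠ φ x := by
  constructor
  · rintro ⟨z, hxz⟩
    exact ne_of_partnerGraph_adj (hφ.mono (by omega)) ((matchingOf_edgeLabel_adj hφ hf).1 hxz)
  · intro hx
    obtain ⟨z, hxz⟩ := (hf x).resolve_left hx
    exact ⟨z, (matchingOf_edgeLabel_adj hφ hf).2 hxz⟩

theorem mul_matchingNumber_le [Finite V] {K : ℕ} (hK : 0 < K) (hφ : IsSeparating G (3 * K) φ)
    (hφ₆ : IsSeparating G 6 φ) {L : List (Pattern N K)} (hL : ∀ p, p ∈ L) :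
    K * matchingNumber G ≤
      K * (matchingOf G (edgeLabel φ ((sweep G φ L)^[K ^ 2] φ))).edgeSet.ncard +
        2 * Nat.card V := by
  have := Fintype.ofFinite V
  obtain ⟨M, hM, hMcard⟩ := (matchingNumber_isGreatest G).1
  obtain ⟨g, hg, hgcard⟩ := exists_isPartnerLabeling_of_isMatching (hφ₆.mono (by omega)) hM
  have hf := isPartnerLabeling_iterate_sweep (L := L) hK hφ (K ^ 2)
  have hfcard := card_unmatched_add (isMatching_matchingOf_edgeLabel hφ₆ hf)
    (mem_verts_matchingOf_edgeLabel hφ₆ hf)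
  have hgap := mul_card_unmatched_iterate_sweep_le hK hφ (hφ₆.mono (by omega)) hL hg
  rw [hMcard] at hgcard
  rw [Nat.card_eq_fintype_card]
  have hKf := congrArg (K * ·) hfcard
  have hKg := congrArg (K * ·) hgcard
  simp only [mul_add, mul_left_comm K 2] at hKf hKg
  omega

theorem matchingNumber_sub_mul_card_le [Finite V] {K : ℕ} {ε : ℝ} (hK : 0 < K) (hKε : 2 ≤ K * ε)
    (hφ : IsSeparating G (3 * K) φ) (hφ₆ : IsSeparating G 6 φ) {L : List (Pattern N K)}
    (hL : ∀ p, p ∈ L) :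
    matchingNumber G - ε * Nat.card V ≤
      (matchingOf G (edgeLabel φ ((sweep G φ L)^[K ^ 2] φ))).edgeSet.ncard := by
  have hbound : (K * matchingNumber G : ℝ) ≤
      K * (matchingOf G (edgeLabel φ ((sweep G φ L)^[K ^ 2] φ))).edgeSet.ncard +
        2 * Nat.card V := by
    exact_mod_cast mul_matchingNumber_le hK hφ hφ₆ hL
  have hcard := mul_le_mul_of_nonneg_right hKε (Nat.cast_nonneg (α := ℝ) (Nat.card V))
  refine le_of_mul_le_mul_left ?_ (Nat.cast_pos.2 hK : (0 : ℝ) < K)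
  linarith

end Matching

end LocalMatching

theorem mainTheorem7 (d : ℕ) (hd : 0 < d) (ε : ℝ) (hε : 0 < ε) :
    ∃ (n l : ℕ) (N Q : Type) (_ : Finite N) (_ : Finite Q)
      (Θ : LocalMatching.BallType d l n N → Q),
      1 ≤ n ∧ n ≤ l ∧ LocalMatching.IsLarge n d N ∧ LocalMatching.IsLarge 5 d Q ∧
      ∀ (V : Type*) [Finite V] (G : SimpleGraph V) (hG : LocalMatching.DegreeBounded G d)
        (φ : V → N) (hφ : LocalMatching.IsSeparating G n φ),
        LocalMatching.IsMatchingFunction G (LocalMatching.run Θ hG hφ) ∧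
        (LocalMatching.matchingOf G (LocalMatching.run Θ hG hφ)).IsMatching ∧
        (LocalMatching.matchingNumber G : ℝ) - ε * (Nat.card V : ℝ) ≤
          ((LocalMatching.matchingOf G (LocalMatching.run Θ hG hφ)).edgeSet.ncard : ℝ) := by
  obtain ⟨K, hKε⟩ := exists_nat_ge (2 / ε)
  have hK : 0 < K := Nat.cast_pos.1 ((div_pos two_pos hε).trans_le hKε)
  let n := 3 * K + 6
  let N := Fin ((d + 1) ^ n)
  have hN : (d + 1) ^ n ≤ Nat.card N := (Nat.card_fin _).ge
  have hQ : (d + 1) ^ 5 ≤ Nat.card (Sym2 N) :=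
    ((Nat.pow_le_pow_right d.succ_pos (by omega)).trans hN).trans
      (Nat.card_le_card_of_injective Sym2.diag Sym2.diag_injective)
  obtain ⟨L, -, hL⟩ := Finite.exists_univ_list (LocalMatching.Pattern N K)
  obtain ⟨l, hnl, Θ, hΘ⟩ :=
    (LocalMatching.isLocal_edgeLabel_iterate_sweep L (K ^ 2)).exists_run_eq d n
  refine ⟨n, l, N, Sym2 N, inferInstance, inferInstance, Θ, by omega, hnl,
    LocalMatching.isLarge_of_pow_le_card hN, LocalMatching.isLarge_of_pow_le_card hQ,
    fun V _ G hG φ hφ => ?_⟩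
  have hφ₆ : LocalMatching.IsSeparating G 6 φ := hφ.mono (by omega)
  have hφK : LocalMatching.IsSeparating G (3 * K) φ := hφ.mono (by omega)
  have hf := LocalMatching.isPartnerLabeling_iterate_sweep (L := L) hK hφK (K ^ 2)
  rw [hΘ V G hG φ hφ]
  exact ⟨LocalMatching.isMatchingFunction_edgeLabel hφ₆ hf,
    LocalMatching.isMatching_matchingOf_edgeLabel hφ₆ hf,
    LocalMatching.matchingNumber_sub_mul_card_le hK ((div_le_iff₀ hε).1 hKε) hφK hφ₆ hL⟩
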